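/- Let $\mathcal A$ be a finite alphabet and let $\mathbf u = u_0u_1u_2\cdots \in \mathcal A^{\mathbb N}$ be an infinite word. Let $\mathcal L(\mathbf u)$ be the set of all finite factors of $\mathbf u$ (including the empty word). For a finite word $w = w_0\cdots w_{n-1}$ write $|w| = n$ and $\widetilde w = w_{n-1}\cdots w_0$; $w$ is a palindrome if $w = \widetilde w$. The palindromic defect of a finite word is $D(w) = |w| + 1 - \#\{p : p \text{ is a factor of } w,\ p = \widetilde p\}$ (the empty word is counted as a palindromic factor), and $D(\mathbf u) = \sup\{D(w) : w \in \mathcal L(\mathbf u)\}$. For $w \in \mathcal L(\mathbf u)$ put \[ E^+(w) = \{b \in \mathcal A : wb \in \mathcal L(\mathbf u)\},\quad E^-(w) = \{a \in \mathcal A : aw \in \mathcal L(\mathbf u)\}, \] \[ E(w) = \{(a,b) \in \mathcal A^2 : awb \in \mathcal L(\mathbf u)\},\quad E^=(w) = \{a \in \mathcal A : awa \in \mathcal L(\mathbf u)\}, \] and $m(w) = \#E(w) - \#E^+(w) - \#E^-(w) + 1$. A factor $w \in \mathcal L(\mathbf u)$ is bispecial if $\#E^-(w) > 1$ and $\#E^+(w)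 > 1$. Theorem. Suppose that $\mathcal L(\mathbf u)$ is closed under reversal, i.e. $w \in \mathcal L(\mathbf u)$ implies $\widetilde w \in \mathcal L(\mathbf u)$, and that $D(\mathbf u) < +\infty$. Then there exists an integer $K$ such that each bispecial factor $w \in \mathcal L(\mathbf u)$ with $|w| \ge K$ satisfies \[ m(w) = \begin{cases} 0 & \text{if } w \neq \widetilde w,\\ \#E^=(w) - 1 & \text{if } w = \widetilde w. \end{cases} \] -/

import Mathlib

/-! Finite words over an alphabet `A` are lists; infinite words are maps `ℕ → A`. -/

namespace InfWord

variable {A : Type*}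

/-- `i` is an occurrence of the finite word `w` in the infinite word `u`, that is,
`u i, u (i + 1), …, u (i + |w| - 1)` spells `w`. -/
def OccursAt (u : ℕ → A) (w : List A) (i : ℕ) : Prop :=
  ∀ (k : ℕ) (hk : k < w.length), w[k] = u (i + k)

/-- The language of `u`: the set of all its (finite) factors, including the empty word. -/
def language (u : ℕ → A) : Set (List A) :=
  {w | ∃ i, OccursAt u w i}

/-- A finite word is a palindrome if it equals its reversal. -/
def IsPalindrome (w : List A) : Prop :=
  w = w.reverse

/-- The language of `u` is closed under reversal. -/
def ClosedUnderReversal (u : ℕ → A) : Prop :=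
  ∀ w ∈ language u, w.reverse ∈ language u

/-- The set of palindromic factors of a finite word, including the empty word. -/
def palindromicFactors (w : List A) : Set (List A) :=
  {p | p <:+: w ∧ IsPalindrome p}

/-- The palindromic defect `|w| + 1 - #(palindromic factors of w)` of a finite word. -/
noncomputable def wordDefect (w : List A) : ℤ :=
  (w.length : ℤ) + 1 - ((palindromicFactors w).ncard : ℤ)

/-- The palindromic defect of an infinite word: the supremum, possibly `+∞`, of the defects of
its factors. -/
noncomputable def defect (u : ℕ → A) : EReal :=
  ⨆ w ∈ language u, (((wordDefect w : ℤ) : ℝ) : EReal)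

/-- Right extensions of `w`. -/
def rightExt (u : ℕ → A) (w : List A) : Set A :=
  {b | w ++ [b] ∈ language u}

/-- Left extensions of `w`. -/
def leftExt (u : ℕ → A) (w : List A) : Set A :=
  {a | [a] ++ w ∈ language u}

/-- Two-sided extensions of `w`. -/
def biExt (u : ℕ → A) (w : List A) : Set (A × A) :=
  {p | [p.1] ++ w ++ [p.2] ∈ language u}

/-- Symmetric two-sided extensions of `w`. -/
def symExt (u : ℕ → A) (w : List A) : Set A :=
  {a | [a] ++ w ++ [a] ∈ language u}

/-- `w` is a bispecial factor of `u`: a factor with more than one left extension and more than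
one right extension. -/
def IsBispecial (u : ℕ → A) (w : List A) : Prop :=
  w ∈ language u ∧ 1 < (leftExt u w).ncard ∧ 1 < (rightExt u w).ncard

/-- The bilateral multiplicity `m(w) = #E(w) - #E⁺(w) - #E⁻(w) + 1`. -/
noncomputable def bilateralMultiplicity (u : ℕ → A) (w : List A) : ℤ :=
  ((biExt u w).ncard : ℤ) - ((rightExt u w).ncard : ℤ) - ((leftExt u w).ncard : ℤ) + 1

end InfWord

namespace InfWord

variable {A : Type*}

/-! Lengthening a prefix by one letter adds at most one palindromic factor, so prefix defects are
nondecreasing. As they are bounded, they stabilise: every sufficiently long prefix ends in a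
palindrome not seen before (`exists_new_palindrome`). Hence, for long `w`, the stretch of `u`
spanned by two consecutive occurrences of `w` or `w.reverse` is a palindrome
(`exists_isPalindrome_between`).

Read off the left extensions at the successive occurrences of `w` or `w.reverse`. By this
palindromicity each one is the reversal of the preceding right extension, so the sequence is a walk
whose edges are the two-sided extensions. The same palindromicity, one letter longer, makes every
excursion from a vertex return along the edge it left by. Apart from loops the graph is therefore a
tree (`ncard_offDiag_walk`), with `2 * (V - 1)` oriented edges on `V` vertices; expressing both
counts through extension sets gives the two formulas. -/

/-! ### Factors as segments of `u`, and reflection of subsegments -/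

/-- The factor of `u` of length `n` starting at position `i`. -/
def seg (u : ℕ → A) (i n : ℕ) : List A :=
  List.ofFn fun k : Fin n => u (i + k)

@[simp] theorem length_seg (u : ℕ → A) (i n : ℕ) : (seg u i n).length = n := by
  simp [seg]

@[simp] theorem getElem_seg (u : ℕ → A) (i n k : ℕ) (hk : k < (seg u i n).length) :
    (seg u i n)[k] = u (i + k) := by
  simp [seg]

theorem occursAt_iff (u : ℕ → A) (w : List A) (i : ℕ) :
    OccursAt u w i ↔ w = seg u i w.length := by
  constructor
  · intro h
    apply List.ext_getElem (by simp)
    intro k h1 h2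
    simpa using h k h1
  · intro h k hk
    rw [List.getElem_of_eq h hk, getElem_seg]

theorem seg_mem_language (u : ℕ → A) (i n : ℕ) : seg u i n ∈ language u :=
  ⟨i, (occursAt_iff _ _ _).2 (by simp)⟩

theorem exists_seg_of_mem_language {u : ℕ → A} {w : List A} (h : w ∈ language u) :
    ∃ i, w = seg u i w.length := by
  obtain ⟨i, hi⟩ := h
  exact ⟨i, (occursAt_iff _ _ _).1 hi⟩

theorem seg_eq_seg_iff {u : ℕ → A} {i j n : ℕ} :
    seg u i n = seg u j n ↔ ∀ k < n, u (i + k) = u (j + k) := by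
  constructor
  · intro h k hk
    have := List.getElem_of_eq h (i := k) (by simpa)
    simpa using this
  · intro h
    apply List.ext_getElem (by simp)
    intro k h1 h2
    simpa using h k (by simpa using h1)

theorem reverse_seg_eq_seg_iff {u : ℕ → A} {i j n : ℕ} :
    (seg u i n).reverse = seg u j n ↔ ∀ k < n, u (i + (n - 1 - k)) = u (j + k) := by
  constructor
  · intro h k hk
    have := List.getElem_of_eq h (i := k) (by simpa)
    simpa using this
  · intro h
    apply List.ext_getElem (by simp)
    intro k h1 h2
    simpa using h k (by simpa using h1)

theorem seg_eq_seg_sub {u : ℕ → A} {i j n : ℕ} (h : seg u i n = seg u j n) (s m : ℕ)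
    (hs : s + m ≤ n) : seg u (i + s) m = seg u (j + s) m := by
  rw [seg_eq_seg_iff] at *
  intro k hk
  simpa [add_assoc] using h (s + k) (by omega)

theorem reverse_seg_eq_seg_sub {u : ℕ → A} {i j n : ℕ} (h : (seg u i n).reverse = seg u j n)
    (s m : ℕ) (hs : s + m ≤ n) :
    (seg u (i + s) m).reverse = seg u (j + (n - s - m)) m := by
  rw [reverse_seg_eq_seg_iff] at *
  intro k hk
  have := h (n - s - m + k) (by omega)
  rw [show i + s + (m - 1 - k) = i + (n - 1 - (n - s - m + k)) by omega, this, add_assoc]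

theorem seg_succ (u : ℕ → A) (i n : ℕ) : seg u i (n + 1) = u i :: seg u (i + 1) n := by
  simp [seg, List.ofFn_succ, add_assoc, add_comm 1]

theorem seg_succ_last (u : ℕ → A) (i n : ℕ) : seg u i (n + 1) = seg u i n ++ [u (i + n)] := by
  apply List.ext_getElem (by simp)
  intro k h1 h2
  simp only [length_seg] at h1
  rcases Nat.lt_succ_iff_lt_or_eq.1 h1 with h | rfl
  · simp [h]
  · simp

theorem seg_add (u : ℕ → A) (i m n : ℕ) : seg u i (m + n) = seg u i m ++ seg u (i + m) n := by
  induction n with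
  | zero => simp [seg]
  | succ n ih => rw [← add_assoc, seg_succ_last, ih, seg_succ_last, List.append_assoc, add_assoc]

theorem seg_infix (u : ℕ → A) {i l m : ℕ} (h : i + l ≤ m) : seg u i l <:+: seg u 0 m := by
  refine ⟨seg u 0 i, seg u (i + l) (m - (i + l)), ?_⟩
  obtain ⟨r, rfl⟩ := Nat.exists_eq_add_of_le h
  rw [seg_add, seg_add]
  simp

theorem exists_seg_of_infix {u : ℕ → A} {m : ℕ} {p : List A} (h : p <:+: seg u 0 m) :
    ∃ i, i + p.length ≤ m ∧ p = seg u i p.length := by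
  obtain ⟨s, t, h⟩ := h
  have hl := congrArg List.length h
  simp at hl
  refine ⟨s.length, by omega, ?_⟩
  apply List.ext_getElem (by simp)
  intro k h1 h2
  have := List.getElem_of_eq h (i := s.length + k) (by simp; omega)
  simpa [List.getElem_append, h1] using this

/-! ### Recurrence -/

/-- In the reversal of a prefix with `N` letters to spare on the right, the reflected segment is
preceded by those `N` letters. -/
theorem exists_reverse_seg_ge {u : ℕ → A} (hrev : ClosedUnderReversal u) (i n N : ℕ) :
    ∃ j ≥ N, (seg u i n).reverse = seg u j n := by
  obtain ⟨q, hq⟩ := exists_seg_of_mem_language (hrev _ (seg_mem_language u 0 (N + i + n)))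
  have hq' : (seg u 0 (N + i + n)).reverse = seg u q (N + i + n) := by simpa using hq
  have := reverse_seg_eq_seg_sub hq' i n (by omega)
  exact ⟨q + (N + i + n - i - n), by omega, by simpa using this⟩

theorem exists_seg_ge {u : ℕ → A} (hrev : ClosedUnderReversal u) (i n N : ℕ) :
    ∃ j ≥ N, seg u i n = seg u j n := by
  obtain ⟨j, -, hj⟩ := exists_reverse_seg_ge hrev i n 0
  obtain ⟨k, hk, hk'⟩ := exists_reverse_seg_ge hrev j n N
  exact ⟨k, hk, by rw [← hk', ← hj, List.reverse_reverse]⟩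

theorem exists_seg_ge_of_mem_language {u : ℕ → A} (hrev : ClosedUnderReversal u) {w : List A}
    (hw : w ∈ language u) (N : ℕ) : ∃ j ≥ N, w = seg u j w.length := by
  obtain ⟨i, hi⟩ := exists_seg_of_mem_language hw
  obtain ⟨j, hj, h⟩ := exists_seg_ge hrev i w.length N
  exact ⟨j, hj, hi.trans h⟩

/-! ### Palindromes in prefixes -/

theorem finite_palindromicFactors (w : List A) : (palindromicFactors w).Finite :=
  (List.finite_toSet w.sublists).subset fun p hp => by
    simpa using hp.1.sublist

theorem palindromicFactors_mono {v w : List A} (h : v <:+: w) :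
    palindromicFactors v ⊆ palindromicFactors w :=
  fun _ hp => ⟨hp.1.trans h, hp.2⟩

theorem eq_seg_of_new_palindrome {u : ℕ → A} {m : ℕ} {p : List A}
    (hp : p ∈ palindromicFactors (seg u 0 (m + 1)) \ palindromicFactors (seg u 0 m)) :
    p.length ≤ m + 1 ∧ p = seg u (m + 1 - p.length) p.length := by
  obtain ⟨⟨h1, h2⟩, h3⟩ := hp
  obtain ⟨i, hi, h⟩ := exists_seg_of_infix h1
  by_cases hm : i + p.length ≤ m
  · exact absurd ⟨by rw [h]; exact seg_infix u hm, h2⟩ h3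
  · rw [show m + 1 - p.length = i by omega]
    exact ⟨by omega, h⟩

/-- New palindromes are suffixes. A shorter one would, by reflection in the longer, also be a prefix
of the longer, hence occur before the last letter. -/
theorem new_palindrome_length_le {u : ℕ → A} {m : ℕ} {p q : List A}
    (hp : p ∈ palindromicFactors (seg u 0 (m + 1)) \ palindromicFactors (seg u 0 m))
    (hq : q ∈ palindromicFactors (seg u 0 (m + 1)) \ palindromicFactors (seg u 0 m)) :
    q.length ≤ p.length := by
  by_contra! hlt
  obtain ⟨hpl, hp'⟩ := eq_seg_of_new_palindrome hp
  obtain ⟨hql, hq'⟩ := eq_seg_of_new_palindrome hq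
  have hqr : (seg u (m + 1 - q.length) q.length).reverse
      = seg u (m + 1 - q.length) q.length := by
    rw [← hq']; exact hq.1.2.symm
  have := reverse_seg_eq_seg_sub hqr (q.length - p.length) p.length (by omega)
  rw [show m + 1 - q.length + (q.length - p.length) = m + 1 - p.length by omega, ← hp',
    show q.length - (q.length - p.length) - p.length = 0 by omega] at this
  apply hp.2
  refine ⟨?_, hp.1.2⟩
  have hpp : p = seg u (m + 1 - q.length + 0) p.length := by rw [← this]; exact hp.1.2
  rw [hpp]
  exact seg_infix u (by simp; omega)

theorem ncard_palindromicFactors_succ_le (u : ℕ → A) (m : ℕ) :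
    (palindromicFactors (seg u 0 (m + 1))).ncard ≤ (palindromicFactors (seg u 0 m)).ncard + 1 := by
  have hsub := palindromicFactors_mono (seg_infix u (show 0 + m ≤ m + 1 by omega))
  have h := Set.ncard_sdiff_add_ncard_of_subset hsub (finite_palindromicFactors _)
  have : (palindromicFactors (seg u 0 (m + 1)) \ palindromicFactors (seg u 0 m)).ncard ≤ 1 := by
    rw [Set.ncard_le_one ((finite_palindromicFactors _).sdiff)]
    intro p hp q hq
    have hl := le_antisymm (new_palindrome_length_le hq hp) (new_palindrome_length_le hp hq)
    rw [(eq_seg_of_new_palindrome hp).2, (eq_seg_of_new_palindrome hq).2, hl]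
  omega

theorem exists_wordDefect_le {u : ℕ → A} (hdef : defect u < ⊤) :
    ∃ B : ℤ, ∀ w ∈ language u, wordDefect w ≤ B := by
  obtain ⟨r, hr, -⟩ := EReal.lt_iff_exists_real_btwn.1 hdef
  refine ⟨⌈r⌉, fun w hw => ?_⟩
  have h1 : (((wordDefect w : ℤ) : ℝ) : EReal) ≤ defect u :=
    le_iSup₂ (f := fun w (_ : w ∈ language u) => (((wordDefect w : ℤ) : ℝ) : EReal)) w hw
  have h2 : ((wordDefect w : ℤ) : ℝ) < r := by exact_mod_cast h1.trans_lt hr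
  exact_mod_cast h2.le.trans (Int.le_ceil r)

theorem exists_new_palindrome {u : ℕ → A} (hdef : defect u < ⊤) :
    ∃ H, ∀ m ≥ H, ∃ l ≤ m + 1, IsPalindrome (seg u (m + 1 - l) l) ∧
      ∀ i, i + l ≤ m → seg u i l ≠ seg u (m + 1 - l) l := by
  obtain ⟨B, hB⟩ := exists_wordDefect_le hdef
  set f : ℕ → ℤ := fun m => wordDefect (seg u 0 m) with hf
  have hmono : Monotone f := monotone_nat_of_le_succ fun m => by
    have := ncard_palindromicFactors_succ_le u m
    simp only [hf, wordDefect, length_seg]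
    push_cast
    omega
  -- `H` is a prefix length at which the bounded integer sequence `f` attains its maximum.
  obtain ⟨-, ⟨H, rfl⟩, hH⟩ := Int.exists_greatest_of_bdd (P := fun z => ∃ m, f m = z)
    ⟨B, by rintro _ ⟨m, rfl⟩; exact hB _ (seg_mem_language u 0 m)⟩ ⟨_, 0, rfl⟩
  refine ⟨H, fun m hm => ?_⟩
  have h1 : f (m + 1) ≤ f m := (hH _ ⟨_, rfl⟩).trans (hmono hm)
  have hne : ¬ palindromicFactors (seg u 0 (m + 1)) ⊆ palindromicFactors (seg u 0 m) := by
    intro hsub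
    have := Set.ncard_le_ncard hsub (finite_palindromicFactors _)
    simp only [hf, wordDefect, length_seg] at h1
    push_cast at h1
    omega
  obtain ⟨p, hp1, hp2⟩ := Set.not_subset.1 hne
  obtain ⟨hl, hp⟩ := eq_seg_of_new_palindrome ⟨hp1, hp2⟩
  refine ⟨p.length, hl, hp ▸ hp1.2, fun i hi h => hp2 ⟨?_, hp1.2⟩⟩
  rw [hp, ← h]
  exact seg_infix u hi

/-! ### Consecutive occurrences of a long factor or its reversal -/

/-- The factors of length `n` at positions `i` and `j` agree up to reversal. -/
def SimAt (u : ℕ → A) (n i j : ℕ) : Prop :=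
  seg u i n = seg u j n ∨ (seg u i n).reverse = seg u j n

theorem SimAt.symm {u : ℕ → A} {n i j : ℕ} (h : SimAt u n i j) : SimAt u n j i := by
  rcases h with h | h
  · exact Or.inl h.symm
  · exact Or.inr (by rw [← h, List.reverse_reverse])

theorem SimAt.trans {u : ℕ → A} {n i j k : ℕ} (h : SimAt u n i j) (h' : SimAt u n j k) :
    SimAt u n i k := by
  rcases h with h | h <;> rcases h' with h' | h'
  · exact Or.inl (h.trans h')
  · exact Or.inr (by rw [h, h'])
  · exact Or.inr (h.trans h')
  · exact Or.inl (by rw [← h', ← h, List.reverse_reverse])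

theorem SimAt.isPalindrome {u : ℕ → A} {n i j : ℕ} (h : SimAt u n i j)
    (hp : IsPalindrome (seg u j n)) : IsPalindrome (seg u i n) := by
  unfold IsPalindrome at *
  rcases h with h | h
  · rwa [h]
  · rw [h, ← List.reverse_reverse (seg u i n), h, ← hp]

/-- The new palindromic suffix of the prefix ending with the block must be the block itself. If it
had length at most `n`, it would already occur in the `n`-block at `e`. So it reflects the final
`n`-block to an earlier position, which cannot lie strictly inside the block; if it started before
`e`, it would reflect the whole block to an earlier copy. -/
theorem isPalindrome_of_first {u : ℕ → A} {n e L l : ℕ} (hn : n < L)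
    (hsim : SimAt u n e (e + (L - n)))
    (hbtw : ∀ k, e < k → k < e + (L - n) → ¬ SimAt u n e k)
    (hfirst : ∀ q < e, ¬ SimAt u L e q)
    (hl : l ≤ e + L) (hpal : IsPalindrome (seg u (e + L - l) l))
    (hnew : ∀ i, i + l < e + L → seg u i l ≠ seg u (e + L - l) l) :
    IsPalindrome (seg u e L) := by
  rcases le_or_gt l n with hln | hln
  · exfalso
    rcases hsim with h | h
    · have := seg_eq_seg_sub h (n - l) l (by omega)
      rw [show e + (L - n) + (n - l) = e + L - l by omega] at this
      exact hnew _ (by omega) this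
    · have := reverse_seg_eq_seg_sub h 0 l (by omega)
      rw [show e + (L - n) + (n - 0 - l) = e + L - l by omega] at this
      refine hnew (e + 0) (by omega) ?_
      rw [hpal, ← this, List.reverse_reverse]
  · have hpal' : (seg u (e + L - l) l).reverse = seg u (e + L - l) l := hpal.symm
    have h1 := reverse_seg_eq_seg_sub hpal' 0 n (by omega)
    rw [add_zero, show e + L - l + (l - 0 - n) = e + (L - n) by omega] at h1
    have h2 : SimAt u n e (e + L - l) := hsim.trans (SimAt.symm (Or.inr h1))
    have hq : e + L - l ≤ e := by
      by_contra! hlt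
      exact hbtw _ hlt (by omega) h2
    have h3 := reverse_seg_eq_seg_sub hpal' 0 L (by omega)
    rw [add_zero, show e + L - l + (l - 0 - L) = e by omega] at h3
    have hq' : e + L - l = e := by
      by_contra hne
      exact hfirst _ (by omega) (SimAt.symm (Or.inr h3))
    rw [hq'] at h3
    exact h3.symm

theorem exists_isPalindrome_between {u : ℕ → A} (hdef : defect u < ⊤) :
    ∃ K, ∀ n ≥ K, ∀ i j, i < j → SimAt u n i j → (∀ k, i < k → k < j → ¬ SimAt u n i k) →
      IsPalindrome (seg u i (j - i + n)) := by
  classical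
  obtain ⟨H, hH⟩ := exists_new_palindrome hdef
  refine ⟨H, fun n hn i j hij hsim hbtw => ?_⟩
  obtain ⟨d, rfl⟩ := Nat.exists_eq_add_of_le hij.le
  rw [Nat.add_sub_cancel_left]
  have hd : 0 < d := by omega
  -- Pass to the first occurrence of the whole block up to reversal; the hypotheses on the
  -- `n`-blocks transfer to it.
  have hex : ∃ e, SimAt u (d + n) i e := ⟨i, Or.inl rfl⟩
  set e := Nat.find hex with he
  have hes : SimAt u (d + n) i e := Nat.find_spec hex
  have hemin : ∀ q < e, ¬ SimAt u (d + n) e q := fun q hq h =>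
    Nat.find_min hex hq (hes.trans h)
  have key : SimAt u n e (e + d) ∧ ∀ k, e < k → k < e + d → ¬ SimAt u n e k := by
    rcases hes with h | h
    · have hs : ∀ s ≤ d, SimAt u n (i + s) (e + s) := fun s hs =>
        Or.inl (seg_eq_seg_sub h s n (by omega))
      have h0 := hs 0 (by omega)
      refine ⟨h0.symm.trans (hsim.trans (hs d le_rfl)), fun k h1 h2 h3 => ?_⟩
      have := hs (k - e) (by omega)
      rw [show e + (k - e) = k by omega] at this
      exact hbtw (i + (k - e)) (by omega) (by omega) (h0.trans (h3.trans this.symm))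
    · have hs : ∀ s ≤ d, SimAt u n (i + s) (e + (d - s)) := fun s hs => by
        have := reverse_seg_eq_seg_sub h s n (by omega)
        rw [show d + n - s - n = d - s by omega] at this
        exact Or.inr this
      have h0 := hs 0 (by omega)
      have h1 := hs d le_rfl
      simp only [Nat.sub_zero, Nat.sub_self, add_zero] at h0 h1
      refine ⟨h1.symm.trans (hsim.symm.trans h0), fun k h2 h3 h4 => ?_⟩
      have := hs (d - (k - e)) (by omega)
      rw [show e + (d - (d - (k - e))) = k by omega] at this
      exact hbtw (i + (d - (k - e))) (by omega) (by omega)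
        (hsim.trans (h1.trans (h4.trans this.symm)))
  obtain ⟨l, hl, hpal, hnew⟩ := hH (e + (d + n) - 1) (by omega)
  rw [show e + (d + n) - 1 + 1 = e + (d + n) by omega] at hl hpal hnew
  exact hes.isPalindrome <| isPalindrome_of_first (n := n) (by omega)
    (by simpa using key.1) (by simpa using key.2) hemin hl hpal fun i hi => hnew i (by omega)

/-! ### Walks all of whose excursions return through the edge they left by -/

/-- First visits define a spanning tree rooted at `X 0`, the parent of `b` being the vertex seen
just before `b` is first reached. Every non-loop step runs along a tree edge, and `hsymm` supplies
both orientations. -/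
theorem ncard_offDiag_walk {α : Type*} (X : ℕ → α) (hfin : (Set.range X).Finite)
    (hret : ∀ s t, s < t → X s = X t → (∀ r, s < r → r < t → X r ≠ X t) → X (s + 1) = X (t - 1))
    (hsymm : ∀ k, ∃ k', X k' = X (k + 1) ∧ X (k' + 1) = X k) :
    (Set.range (fun k => (X k, X (k + 1))) ∩ {p | p.1 ≠ p.2}).ncard + 2
      = 2 * (Set.range X).ncard := by
  classical
  let τ : α → ℕ := fun b => if h : ∃ k, X k = b then Nat.find h else 0
  have hτ : ∀ k, X (τ (X k)) = X k := fun k => by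
    have h : ∃ k', X k' = X k := ⟨k, rfl⟩
    simp only [τ, dif_pos h]
    exact Nat.find_spec h
  have hτmin : ∀ k, τ (X k) ≤ k := fun k => by
    have h : ∃ k', X k' = X k := ⟨k, rfl⟩
    simp only [τ, dif_pos h]
    exact Nat.find_min' h rfl
  have hτpos : ∀ b ∈ Set.range X \ {X 0}, 0 < τ b ∧ X (τ b) = b := by
    rintro _ ⟨⟨k, rfl⟩, hk⟩
    refine ⟨Nat.pos_of_ne_zero fun h0 => hk ?_, hτ k⟩
    have := hτ k
    rw [h0] at this
    exact this.symm
  let W := Set.range X \ {X 0}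
  let F := (fun b => (X (τ b - 1), b)) '' W
  let G := (fun b => (b, X (τ b - 1))) '' W
  have hpred : ∀ b ∈ W, τ (X (τ b - 1)) < τ b := fun b hb => by
    have := hτmin (τ b - 1)
    have := (hτpos b hb).1
    omega
  have hE : Set.range (fun k => (X k, X (k + 1))) ∩ {p | p.1 ≠ p.2} = F ∪ G := by
    ext ⟨a, b⟩
    constructor
    · rintro ⟨⟨k, hk⟩, hne⟩
      simp only [Prod.mk.injEq] at hk
      obtain ⟨rfl, rfl⟩ := hk
      induction k using Nat.strong_induction_on with
      | _ k ih =>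
        by_cases hnew : τ (X (k + 1)) = k + 1
        · left
          refine ⟨X (k + 1), ⟨⟨_, rfl⟩, fun h0 => ?_⟩, by simp [hnew]⟩
          have h1 : X (k + 1) = X 0 := h0
          have := hτmin 0
          rw [← h1] at this
          omega
        -- From the last earlier visit `s` to `X (k + 1)`, `hret` shows that step `s` is step `k`
        -- reversed, so induction applies.
        · have hP : ∃ s, s ≤ k ∧ X s = X (k + 1) :=
            ⟨τ (X (k + 1)), by have := hτmin (k + 1); omega, hτ _⟩
          obtain ⟨s0, hs0, hs0'⟩ := hP
          let s := Nat.findGreatest (fun s => X s = X (k + 1)) k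
          have hs : X s = X (k + 1) :=
            Nat.findGreatest_spec (P := fun s => X s = X (k + 1)) hs0 hs0'
          have hsk : s ≤ k := Nat.findGreatest_le k
          have hsk' : s ≠ k := fun h => hne (by simpa [h] using hs)
          have hr := hret s (k + 1) (by omega) hs fun r h1 h2 =>
            Nat.findGreatest_is_greatest (P := fun s => X s = X (k + 1)) h1 (by omega)
          simp only [Nat.add_sub_cancel] at hr
          have := ih s (by omega) (by
            simp only [Set.mem_ofPred_eq] at hne ⊢
            rw [hs, hr]; exact hne.symm)
          rw [hs, hr] at this
          rcases this with ⟨c, hc, hc'⟩ | ⟨c, hc, hc'⟩ <;> simp only [Prod.mk.injEq] at hc'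
          · right
            exact ⟨c, hc, Prod.ext hc'.2 hc'.1⟩
          · left
            exact ⟨c, hc, Prod.ext hc'.2 hc'.1⟩
    · have hF : ∀ c ∈ W, ∃ k, X k = X (τ c - 1) ∧ X (k + 1) = c := fun c hc =>
        ⟨τ c - 1, rfl, by rw [Nat.sub_add_cancel (hτpos c hc).1]; exact (hτpos c hc).2⟩
      have hneq : ∀ c ∈ W, X (τ c - 1) ≠ c := fun c hc h => by
        have := hpred c hc
        rw [h] at this
        omega
      rintro (⟨c, hc, hc'⟩ | ⟨c, hc, hc'⟩) <;> simp only [Prod.mk.injEq] at hc' <;>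
        obtain ⟨rfl, rfl⟩ := hc' <;> obtain ⟨k, hk, hk'⟩ := hF _ hc
      · exact ⟨⟨k, by simp [hk, hk']⟩, hneq _ hc⟩
      · obtain ⟨k', h1, h2⟩ := hsymm k
        exact ⟨⟨k', by simp [h1, h2, hk, hk']⟩, (hneq _ hc).symm⟩
  have hWfin : W.Finite := hfin.sdiff
  have hdisj : Disjoint F G := by
    rw [Set.disjoint_left]
    rintro _ ⟨b, hb, rfl⟩ ⟨c, hc, h⟩
    simp only [Prod.mk.injEq] at h
    have h1 := hpred b hb
    have h2 := hpred c hc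
    rw [h.2] at h2
    rw [← h.1] at h1
    omega
  have hFc : F.ncard = W.ncard := Set.ncard_image_of_injective _ fun b c h => (Prod.ext_iff.1 h).2
  have hGc : G.ncard = W.ncard := Set.ncard_image_of_injective _ fun b c h => (Prod.ext_iff.1 h).1
  have hWc : W.ncard + 1 = (Set.range X).ncard :=
    Set.ncard_sdiff_singleton_add_one ⟨0, rfl⟩ hfin
  rw [hE, Set.ncard_union_eq hdisj (hWfin.image _) (hWfin.image _), hFc, hGc]
  omega


/-! ### The walk along the occurrences of a factor and its reversal -/

theorem exists_enum_occurrences {u : ℕ → A} (hrev : ClosedUnderReversal u) {w : List A}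
    (hw : w ∈ language u) :
    ∃ p : ℕ → ℕ, StrictMono p ∧
      ∀ i, i ∈ Set.range p ↔ 1 ≤ i ∧ (seg u i w.length = w ∨ seg u i w.length = w.reverse) := by
  classical
  -- Position `0` is excluded so that a left letter always exists.
  let S : Set ℕ := {i | 1 ≤ i ∧ (seg u i w.length = w ∨ seg u i w.length = w.reverse)}
  have hS : S.Infinite := Set.infinite_of_forall_exists_gt fun N => by
    obtain ⟨j, hj, h⟩ := exists_seg_ge_of_mem_language hrev hw (N + 1)
    exact ⟨j, ⟨by omega, Or.inl h.symm⟩, by omega⟩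
  have := hS.to_subtype
  refine ⟨Nat.orderEmbeddingOfSet S, (Nat.orderEmbeddingOfSet S).strictMono, fun i => ?_⟩
  rw [Nat.orderEmbeddingOfSet_range S]
  rfl

/-- The left extensions of `w` and of its reversal, as factors of length `|w| + 1`. -/
def walkVertices (u : ℕ → A) (w : List A) : Set (List A) :=
  {z | ∃ l y, (y = w ∨ y = w.reverse) ∧ l :: y ∈ language u ∧ z = l :: y}

/-- The pairs consisting of a left extension `l y` and the reversal of a right extension `y r`,
where `y` is `w` or its reversal and `l y r` is a factor. -/
def walkEdges (u : ℕ → A) (w : List A) : Set (List A × List A) :=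
  {z | ∃ l r y, (y = w ∨ y = w.reverse) ∧ [l] ++ y ++ [r] ∈ language u ∧
    z = (l :: y, r :: y.reverse)}

/-- The walk `X` of left extensions meets the tree criterion: `hK` at length `n` makes consecutive
vertices an edge, and `hK` at length `n + 1` gives the return condition. -/
theorem ncard_walkEdges_offDiag [Finite A] {u : ℕ → A} (hrev : ClosedUnderReversal u) {K : ℕ}
    (hK : ∀ n ≥ K, ∀ i j, i < j → SimAt u n i j → (∀ k, i < k → k < j → ¬ SimAt u n i k) →
      IsPalindrome (seg u i (j - i + n)))
    {w : List A} (hw : w ∈ language u) (hlen : K ≤ w.length) :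
    (walkEdges u w ∩ {p | p.1 ≠ p.2}).ncard + 2 = 2 * (walkVertices u w).ncard := by
  obtain ⟨p, hmono, hp⟩ := exists_enum_occurrences hrev hw
  generalize hn : w.length = n at hp hlen
  have hp1 : ∀ k, 1 ≤ p k := fun k => ((hp _).1 ⟨k, rfl⟩).1
  have hpw : ∀ k, seg u (p k) n = w ∨ seg u (p k) n = w.reverse := fun k =>
    ((hp _).1 ⟨k, rfl⟩).2
  have hsim : ∀ k i, 1 ≤ i → (SimAt u n (p k) i ↔ i ∈ Set.range p) := fun k i hi => by
    rw [hp]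
    constructor
    · rintro (h | h)
      · rw [← h]; exact ⟨hi, hpw k⟩
      · rw [← h]
        rcases hpw k with h' | h' <;> simp [h', hi]
    · rintro ⟨-, h⟩
      rcases hpw k with h' | h' <;> rcases h with h | h <;> simp [SimAt, h, h']
  let X : ℕ → List A := fun k => seg u (p k - 1) (n + 1)
  have hX : ∀ k, X k = u (p k - 1) :: seg u (p k) n := fun k => by
    simp only [X]
    rw [seg_succ, Nat.sub_add_cancel (hp1 k)]
  have hstep : ∀ k, (seg u (p k) (n + 1)).reverse = X (k + 1) := fun k => by
    have hlt : p k < p (k + 1) := hmono (Nat.lt_succ_self k)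
    have hpal := hK n hlen (p k) (p (k + 1)) hlt ((hsim k _ (hp1 _)).2 ⟨_, rfl⟩)
      fun i h1 h2 h3 => by
        obtain ⟨m, rfl⟩ := (hsim k i ((hp1 k).trans h1.le)).1 h3
        have := hmono.lt_iff_lt.1 h1
        have := hmono.lt_iff_lt.1 h2
        omega
    have := reverse_seg_eq_seg_sub hpal.symm 0 (n + 1) (by omega)
    rw [add_zero, show p k + (p (k + 1) - p k + n - 0 - (n + 1)) = p (k + 1) - 1 by omega] at this
    exact this
  have hX' : ∀ k, X (k + 1) = u (p k + n) :: (seg u (p k) n).reverse := fun k => by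
    rw [← hstep, seg_succ_last]
    simp
  have hlyr : ∀ k, seg u (p k - 1) (n + 2) = [u (p k - 1)] ++ seg u (p k) n ++ [u (p k + n)] :=
    fun k => by
      have := hp1 k
      rw [seg_succ_last, seg_succ, Nat.sub_add_cancel (hp1 k),
        show p k - 1 + (n + 1) = p k + n by omega]
      rfl
  have hV : Set.range X = walkVertices u w := by
    ext z
    constructor
    · rintro ⟨k, rfl⟩
      exact ⟨_, _, hpw k, hX k ▸ seg_mem_language _ _ _, hX k⟩
    · rintro ⟨l, y, hy, hly, rfl⟩
      have hyn : y.length = n := by rcases hy with rfl | rfl <;> simp [hn]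
      obtain ⟨j, hj⟩ := exists_seg_of_mem_language hly
      rw [List.length_cons, hyn] at hj
      have hj' := hj
      rw [seg_succ] at hj'
      obtain ⟨k, hk⟩ := (hp (j + 1)).2 ⟨by omega, by
        rw [← (List.cons_eq_cons.1 hj').2]; exact hy⟩
      exact ⟨k, by rw [hj]; simp only [X, hk, Nat.add_sub_cancel]⟩
  have hE : Set.range (fun k => (X k, X (k + 1))) = walkEdges u w := by
    ext z
    constructor
    · rintro ⟨k, rfl⟩
      exact ⟨_, _, _, hpw k, hlyr k ▸ seg_mem_language _ _ _, Prod.ext (hX k) (hX' k)⟩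
    · rintro ⟨l, r, y, hy, hly, rfl⟩
      have hyn : y.length = n := by rcases hy with rfl | rfl <;> simp [hn]
      obtain ⟨j, hj⟩ := exists_seg_of_mem_language hly
      rw [show ([l] ++ y ++ [r]).length = n + 2 by simp [hyn], seg_succ_last, seg_succ] at hj
      obtain ⟨h1, h2⟩ := List.append_inj hj (by simp [hyn])
      obtain ⟨h3, h4⟩ := List.cons_eq_cons.1 h1
      obtain ⟨k, hk⟩ := (hp (j + 1)).2 ⟨by omega, by rw [← show y = _ from h4]; exact hy⟩
      have h5 : r = u (j + (n + 1)) := by simpa using h2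
      refine ⟨k, ?_⟩
      simp only [hX', hX k, hk, Nat.add_sub_cancel]
      rw [← show y = _ from h4, h3, h5, show j + 1 + n = j + (n + 1) by omega]
  have hret : ∀ s t, s < t → X s = X t → (∀ r, s < r → r < t → X r ≠ X t) →
      X (s + 1) = X (t - 1) := by
    intro s t hst hXst hr
    have ht : t - 1 + 1 = t := by omega
    have hle : p s ≤ p (t - 1) := hmono.monotone (by omega)
    have h1s := hp1 s
    have hback := hstep (t - 1)
    rw [ht, ← hXst] at hback
    -- The vertex `X s = X t` sits at `p s - 1`, its reversal at `p (t - 1)`. Any copy of either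
    -- strictly between would be a visit to `X t` at an intermediate time.
    have hpal := hK (n + 1) (by omega) (p s - 1) (p (t - 1)) (by omega)
      (SimAt.symm (Or.inr hback)) fun i h1 h2 h3 => by
        rcases h3 with h3 | h3
        · have h4 : X s = seg u (i + 1 - 1) (n + 1) := h3
          have h5 := h4
          rw [hX, Nat.add_sub_cancel, seg_succ] at h5
          obtain ⟨k, hk⟩ := (hp (i + 1)).2 ⟨by omega, by
            rw [← (List.cons_eq_cons.1 h5).2]; exact hpw s⟩
          have hks : s < k := hmono.lt_iff_lt.1 (by omega)
          have hkt : k < t := by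
            by_contra! hge
            have := hmono.lt_iff_lt.2 (show t - 1 < k by omega)
            omega
          exact hr k hks hkt (by rw [← hXst, h4, ← hk])
        · have h4 := h3
          have h5 : X s = (seg u i (n + 1)).reverse := by rw [← h3]; simp [X]
          have h6 := h5
          rw [hX, seg_succ_last, List.reverse_append] at h6
          have h7 : seg u (p s) n = (seg u i n).reverse := (List.cons_eq_cons.1 h6).2
          obtain ⟨k, rfl⟩ := (hsim s i (by omega)).1 (Or.inr (by rw [h7]; simp))
          have hks : s ≤ k := hmono.le_iff_le.1 (by omega)
          have hkt : k < t - 1 := hmono.lt_iff_lt.1 h2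
          exact hr (k + 1) (by omega) (by omega) (by rw [← hXst, h5, hstep])
    -- Reflecting the block one letter in from the left end lands one letter in from the right end,
    -- at `X (t - 1)`.
    have h := reverse_seg_eq_seg_sub hpal.symm 1 (n + 1) (by omega)
    rw [Nat.sub_add_cancel h1s, show p s - 1 + (p (t - 1) - (p s - 1) + (n + 1) - 1 - (n + 1))
      = p (t - 1) - 1 by omega, hstep] at h
    exact h
  have hsymm : ∀ k, ∃ k', X k' = X (k + 1) ∧ X (k' + 1) = X k := fun k => by
    have hmem : (X (k + 1), X k) ∈ walkEdges u w := by
      refine ⟨u (p k + n), u (p k - 1), (seg u (p k) n).reverse, ?_, ?_, ?_⟩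
      · rcases hpw k with h | h <;> simp [h]
      · have := hrev _ (seg_mem_language u (p k - 1) (n + 2))
        rw [hlyr] at this
        simpa using this
      · rw [hX', hX k, List.reverse_reverse]
    rw [← hE] at hmem
    obtain ⟨k', hk'⟩ := hmem
    exact ⟨k', (Prod.ext_iff.1 hk').1, (Prod.ext_iff.1 hk').2⟩
  have hfin : (Set.range X).Finite :=
    (List.finite_length_eq A (n + 1)).subset (by rintro _ ⟨k, rfl⟩; simp [X])
  rw [← hE, ← hV]
  exact ncard_offDiag_walk X hfin hret hsymm

/-! ### Counting extensions -/

theorem append_mem_language_iff {u : ℕ → A} (hrev : ClosedUnderReversal u) (w : List A) (b : A) :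
    b :: w.reverse ∈ language u ↔ w ++ [b] ∈ language u := by
  constructor <;> intro h <;> simpa using hrev _ h

theorem lyr_mem_language_iff {u : ℕ → A} (hrev : ClosedUnderReversal u) (w : List A) (a b : A) :
    [b] ++ w.reverse ++ [a] ∈ language u ↔ [a] ++ w ++ [b] ∈ language u := by
  constructor <;> intro h <;> simpa using hrev _ h

theorem walkVertices_eq {u : ℕ → A} (hrev : ClosedUnderReversal u) (w : List A) :
    walkVertices u w = (· :: w) '' leftExt u w ∪ (· :: w.reverse) '' rightExt u w := by
  ext z
  constructor
  · rintro ⟨l, y, rfl | rfl, h, rfl⟩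
    · exact Or.inl ⟨l, h, rfl⟩
    · exact Or.inr ⟨l, (append_mem_language_iff hrev w l).1 h, rfl⟩
  · rintro (⟨l, h, rfl⟩ | ⟨l, h, rfl⟩)
    · exact ⟨l, w, Or.inl rfl, h, rfl⟩
    · exact ⟨l, _, Or.inr rfl, (append_mem_language_iff hrev w l).2 h, rfl⟩

theorem walkEdges_eq {u : ℕ → A} (hrev : ClosedUnderReversal u) (w : List A) :
    walkEdges u w = (fun q : A × A => (q.1 :: w, q.2 :: w.reverse)) '' biExt u w ∪
      (fun q : A × A => (q.2 :: w.reverse, q.1 :: w)) '' biExt u w := by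
  ext z
  constructor
  · rintro ⟨l, r, y, rfl | rfl, h, rfl⟩
    · exact Or.inl ⟨(l, r), h, rfl⟩
    · exact Or.inr ⟨(r, l), (lyr_mem_language_iff hrev w r l).1 h, by simp⟩
  · rintro (⟨⟨l, r⟩, h, rfl⟩ | ⟨⟨l, r⟩, h, rfl⟩)
    · exact ⟨l, r, w, Or.inl rfl, h, rfl⟩
    · exact ⟨r, l, _, Or.inr rfl, (lyr_mem_language_iff hrev w l r).2 h, by simp⟩

/-- Extensions of `w` and of `w.reverse` are distinct vertices, so there are no loops and each
two-sided extension gives two oriented edges. -/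
theorem bilateralMultiplicity_of_not_isPalindrome [Finite A] {u : ℕ → A}
    (hrev : ClosedUnderReversal u) {w : List A} (hpal : ¬ IsPalindrome w)
    (h : (walkEdges u w ∩ {p | p.1 ≠ p.2}).ncard + 2 = 2 * (walkVertices u w).ncard) :
    bilateralMultiplicity u w = 0 := by
  have hne : w ≠ w.reverse := hpal
  have hV : (walkVertices u w).ncard = (leftExt u w).ncard + (rightExt u w).ncard := by
    rw [walkVertices_eq hrev, Set.ncard_union_eq _ (Set.toFinite _) (Set.toFinite _),
      Set.ncard_image_of_injective _ fun a b h => by simpa using h,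
      Set.ncard_image_of_injective _ fun a b h => by simpa using h]
    rw [Set.disjoint_left]
    rintro _ ⟨a, -, rfl⟩ ⟨b, -, h⟩
    exact hne (List.cons_eq_cons.1 h).2.symm
  have hoff : walkEdges u w ∩ {p | p.1 ≠ p.2} = walkEdges u w := by
    rw [Set.inter_eq_left, walkEdges_eq hrev]
    rintro _ (⟨q, -, rfl⟩ | ⟨q, -, rfl⟩) h
    · exact hne (List.cons_eq_cons.1 h).2
    · exact hne (List.cons_eq_cons.1 h).2.symm
  have hE : (walkEdges u w).ncard = 2 * (biExt u w).ncard := by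
    rw [walkEdges_eq hrev, Set.ncard_union_eq _ (Set.toFinite _) (Set.toFinite _),
      Set.ncard_image_of_injective _ fun a b h => by simpa [Prod.ext_iff] using h,
      Set.ncard_image_of_injective _ fun a b h => by
        simpa [Prod.ext_iff, and_comm] using h, two_mul]
    rw [Set.disjoint_left]
    rintro _ ⟨a, -, rfl⟩ ⟨b, -, h⟩
    exact hne (List.cons_eq_cons.1 (Prod.ext_iff.1 h).1).2.symm
  rw [hoff, hE, hV] at h
  unfold bilateralMultiplicity
  omega

/-- Left and right extensions give the same vertices, each two-sided extension is one oriented edge,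
and the loops are exactly the symmetric extensions. -/
theorem bilateralMultiplicity_of_isPalindrome [Finite A] {u : ℕ → A}
    (hrev : ClosedUnderReversal u) {w : List A} (hpal : IsPalindrome w)
    (h : (walkEdges u w ∩ {p | p.1 ≠ p.2}).ncard + 2 = 2 * (walkVertices u w).ncard) :
    bilateralMultiplicity u w = ((symExt u w).ncard : ℤ) - 1 := by
  have hw : w.reverse = w := Eq.symm hpal
  have hLR : leftExt u w = rightExt u w := by
    ext b
    have := append_mem_language_iff hrev w b
    rwa [hw] at this
  have hV : (walkVertices u w).ncard = (rightExt u w).ncard := by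
    rw [walkVertices_eq hrev, hw, hLR, Set.union_self,
      Set.ncard_image_of_injective _ fun a b h => by simpa using h]
  have hE : walkEdges u w ∩ {p | p.1 ≠ p.2} =
      (fun q : A × A => (q.1 :: w, q.2 :: w)) '' (biExt u w \ (fun a => (a, a)) '' symExt u w) := by
    ext z
    constructor
    · rintro ⟨⟨l, r, y, hy, hm, rfl⟩, hne⟩
      rw [hw, or_self] at hy
      subst hy
      refine ⟨(l, r), ⟨hm, ?_⟩, by simp [hw]⟩
      rintro ⟨a, -, ha⟩
      simp only [Prod.mk.injEq] at ha
      exact hne (by simp [hw, ← ha.1, ← ha.2])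
    · rintro ⟨⟨l, r⟩, ⟨hm, hd⟩, rfl⟩
      refine ⟨⟨l, r, w, Or.inl rfl, hm, by simp [hw]⟩, fun h => hd ?_⟩
      have hlr : l = r := (List.cons_eq_cons.1 h).1
      subst hlr
      exact ⟨l, hm, rfl⟩
  have hEc : (walkEdges u w ∩ {p | p.1 ≠ p.2}).ncard + (symExt u w).ncard
      = (biExt u w).ncard := by
    rw [hE, Set.ncard_image_of_injective _ fun a b h => by simpa [Prod.ext_iff] using h,
      ← Set.ncard_image_of_injective (symExt u w)
        (show Function.Injective fun a : A => (a, a) from fun a b h => (Prod.ext_iff.1 h).1)]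
    exact Set.ncard_sdiff_add_ncard_of_subset (by rintro _ ⟨a, ha, rfl⟩; exact ha)
  unfold bilateralMultiplicity
  rw [hLR]
  rw [hV] at h
  omega

end InfWord

theorem mainTheorem3 {A : Type*} [Finite A] (u : ℕ → A)
    (hrev : InfWord.ClosedUnderReversal u) (hdef : InfWord.defect u < ⊤) :
    ∃ K : ℕ, ∀ w : List A, InfWord.IsBispecial u w → K ≤ w.length →
      (¬ InfWord.IsPalindrome w → InfWord.bilateralMultiplicity u w = 0) ∧
      (InfWord.IsPalindrome w →
        InfWord.bilateralMultiplicity u w = ((InfWord.symExt u w).ncard : ℤ) - 1) := by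
  obtain ⟨K, hK⟩ := InfWord.exists_isPalindrome_between hdef
  refine ⟨K, fun w hw hlen => ?_⟩
  have h := InfWord.ncard_walkEdges_offDiag hrev hK hw.1 hlen
  exact ⟨fun hp => InfWord.bilateralMultiplicity_of_not_isPalindrome hrev hp h,
    fun hp => InfWord.bilateralMultiplicity_of_isPalindrome hrev hp h⟩
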